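/- Let $\Omega\subset\mathbb R^N$ be a bounded open set and let $j:\Omega\times\mathbb R\times\mathbb R^N\to\mathbb R$ be such that $j(\cdot,s,\xi)$ is measurable for all $(s,\xi)$ and $j(x,\cdot,\cdot)$ is of class $C^1$ for a.e. $x\in\Omega$; write $j_s$ and $j_\xi$ for its derivatives in $s$ and $\xi$. Assume that there are continuous functions $\gamma,\mu:[0,\infty)\to[0,\infty)$ with $$|j_s(x,s,\xi)|\le\gamma(|s|)\,|\xi|^2,\qquad |j_\xi(x,s,\xi)|\le\mu(|s|)\,|\xi|$$ for a.e. $x\in\Omega$ and all $(s,\xi)\in\mathbb R\times\mathbb R^N$. For a measurable $u:\Omega\to\mathbb R$ put $$V_u=\{z\in H^1_0(\Omega)\cap L^\infty(\Omega):\ u\in L^\infty(\{z\ne0\})\}.$$ Let $w\in H^{-1}(\Omega)$ (the dual of $H^1_0(\Omega)$) and let $u\in H^1_0(\Omega)$ satisfy $$\int_\Omega j_\xi(x,u,\nabla u)\cdot\nabla z+\int_\Omega j_s(x,u,\nabla u)\,z=\langle w,z\rangle\qquad\text{for all }z\in V_u,$$ and suppose that $j_\xi(x,u,\nabla u)\cdot\nabla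 u\in L^1(\Omega)$. (a) If $v\in H^1_0(\Omega)$ and $\eta\in L^1(\Omega)$ satisfy $j_s(x,u,\nabla u)\,v\ge\eta$ and $j_\xi(x,u,\nabla u)\cdot\nabla v\ge\eta$ a.e. in $\Omega$, then $j_s(x,u,\nabla u)\,v\in L^1(\Omega)$, $j_\xi(x,u,\nabla u)\cdot\nabla v\in L^1(\Omega)$ and $$\int_\Omega j_\xi(x,u,\nabla u)\cdot\nabla v+\int_\Omega j_s(x,u,\nabla u)\,v=\langle w,v\rangle.$$ (b) Suppose in addition that there are $\varepsilon\in(0,1)$ and $R\ge0$ such that $$(1-\varepsilon)\,j_\xi(x,s,\xi)\cdot\xi+j_s(x,s,\xi)\,s\ge0$$ for a.e. $x\in\Omega$ and all $(s,\xi)\in\mathbb R\times\mathbb R^N$ with $|s|\ge R$. If $\zeta\in L^\infty(\Omega)$, $\zeta\ge0$, $\zeta u\in H^1_0(\Omega)$ and $j_\xi(x,u,\nabla u)\cdot\nabla(\zeta u)\in L^1(\Omega)$, then $j_s(x,u,\nabla u)\,\zeta u\in L^1(\Omega)$ and $$\int_\Omega j_\xi(x,u,\nabla u)\cdot\nabla(\zeta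 u)+\int_\Omega j_s(x,u,\nabla u)\,\zeta u=\langle w,\zeta u\rangle.$$ -/

import Mathlib

open MeasureTheory
open scoped ContDiff NNReal ENNReal

noncomputable section

/-- `ℝ^N` with its Euclidean structure. -/
abbrev RN (N : ℕ) : Type := EuclideanSpace ℝ (Fin N)

/-- `φ ∈ C_c^∞(Ω)`. -/
structure IsTestFunction {N : ℕ} (Ω : Set (RN N)) (φ : RN N → ℝ) : Prop where
  smooth : ContDiff ℝ ∞ φ
  compact : HasCompactSupport φ
  support_subset : tsupport φ ⊆ Ω

/-- The Hilbert space `L²(Ω) × L²(Ω; ℝ^N)` in which `H¹(Ω)` lives as the set of the pairs `(f, ∇f)`;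
its norm is `(‖f‖² + ‖F‖²)^(1/2)`. -/
abbrev L2Pair {N : ℕ} (Ω : Set (RN N)) : Type :=
  WithLp 2 (Lp ℝ 2 (volume.restrict Ω) × Lp (RN N) 2 (volume.restrict Ω))

/-- `F` is the weak gradient of `f` on `Ω`. -/
def HasWeakGradient {N : ℕ} (Ω : Set (RN N)) (f : RN N → ℝ) (F : RN N → RN N) : Prop :=
  ∀ φ : RN N → ℝ, IsTestFunction Ω φ →
    ∫ x in Ω, f x • gradient φ x = - ∫ x in Ω, φ x • F x

/-- The pairs `(φ, ∇φ)` with `φ ∈ C_c^∞(Ω)`, as a subspace of `L²(Ω) × L²(Ω; ℝ^N)`. -/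
def testPairs {N : ℕ} (Ω : Set (RN N)) : Submodule ℝ (L2Pair Ω) where
  carrier := {p | ∃ φ : RN N → ℝ, IsTestFunction Ω φ ∧
    p.fst =ᵐ[volume.restrict Ω] φ ∧ p.snd =ᵐ[volume.restrict Ω] gradient φ}
  zero_mem' := by
    refine ⟨fun _ => 0, ⟨contDiff_const, HasCompactSupport.zero, by simp [tsupport]⟩, ?_, ?_⟩
    · exact Lp.coeFn_zero _ _ _
    · refine (Lp.coeFn_zero _ _ _).trans (Filter.Eventually.of_forall fun x => ?_)
      simp [gradient]
  add_mem' := by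
    rintro p q ⟨φ, hφ, hp, hp'⟩ ⟨ψ, hψ, hq, hq'⟩
    refine ⟨φ + ψ, ⟨hφ.smooth.add hψ.smooth, hφ.compact.add hψ.compact,
      (tsupport_add φ ψ).trans (Set.union_subset hφ.support_subset hψ.support_subset)⟩, ?_, ?_⟩
    · exact (Lp.coeFn_add _ _).trans (hp.add hq)
    · refine (Lp.coeFn_add _ _).trans ((hp'.add hq').trans (Filter.Eventually.of_forall fun x => ?_))
      have h1 := (hφ.smooth.differentiable (by simp)) x
      have h2 := (hψ.smooth.differentiable (by simp)) x
      simp [gradient, fderiv_add h1 h2]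
  smul_mem' := by
    rintro c p ⟨φ, hφ, hp, hp'⟩
    refine ⟨c • φ, ⟨hφ.smooth.const_smul c, hφ.compact.smul_left (f := fun _ => c),
      (tsupport_smul_subset_right (fun _ => c) φ).trans hφ.support_subset⟩, ?_, ?_⟩
    · exact (Lp.coeFn_smul _ _).trans (hp.const_smul c)
    · refine (Lp.coeFn_smul _ _).trans ((hp'.const_smul c).trans
        (Filter.Eventually.of_forall fun x => ?_))
      have h1 := (hφ.smooth.differentiable (by simp)) x
      simp [gradient, fderiv_const_smul h1]

/-- `H¹₀(Ω)`, the closure of `C_c^∞(Ω)` in the `H¹`-norm. An element is the pair `(u, ∇u)`: its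
second component is the weak gradient of the first one (`H10.hasWeakGradient`), hence is determined
by it. -/
abbrev H10 {N : ℕ} (Ω : Set (RN N)) : Submodule ℝ (L2Pair Ω) := (testPairs Ω).topologicalClosure

/-- `H⁻¹(Ω)`, the dual space of `H¹₀(Ω)`. -/
abbrev Hminus1 {N : ℕ} (Ω : Set (RN N)) : Type := StrongDual ℝ (H10 Ω)

namespace H10

variable {N : ℕ} {Ω : Set (RN N)}

/-- The function `u : Ω → ℝ` underlying an element of `H¹₀(Ω)` (defined almost everywhere). -/
def fn (u : H10 Ω) : RN N → ℝ := u.1.fst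

/-- The gradient `∇u : Ω → ℝ^N` of an element of `H¹₀(Ω)` (defined almost everywhere). -/
def grad (u : H10 Ω) : RN N → RN N := u.1.snd

lemma gradient_continuous {φ : RN N → ℝ} (hφ : IsTestFunction Ω φ) : Continuous (gradient φ) :=
  (InnerProductSpace.toDual ℝ (RN N)).symm.continuous.comp
    (hφ.smooth.continuous_fderiv (by simp))

lemma gradient_compact {φ : RN N → ℝ} (hφ : IsTestFunction Ω φ) :
    HasCompactSupport (gradient φ) :=
  (hφ.compact.fderiv (𝕜 := ℝ)).comp_left (g := (InnerProductSpace.toDual ℝ (RN N)).symm) (by simp)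

lemma test_hasWeakGradient {φ : RN N → ℝ} (hφ : IsTestFunction Ω φ) :
    HasWeakGradient Ω φ (gradient φ) := by
  intro ψ hψ
  have hcφ := hφ.smooth.continuous
  have hcψ := hψ.smooth.continuous
  have i1 : Integrable (fun x => φ x • gradient ψ x) :=
    (hcφ.smul (gradient_continuous hψ)).integrable_of_hasCompactSupport hφ.compact.smul_right
  have i2 : Integrable (fun x => ψ x • gradient φ x) :=
    (hcψ.smul (gradient_continuous hφ)).integrable_of_hasCompactSupport hψ.compact.smul_right
  have z1 : ∫ x in Ω, φ x • gradient ψ x = ∫ x, φ x • gradient ψ x :=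
    setIntegral_eq_integral_of_forall_compl_eq_zero fun x hx => by
      rw [image_eq_zero_of_notMem_tsupport (fun h => hx (hφ.support_subset h)), zero_smul]
  have z2 : ∫ x in Ω, ψ x • gradient φ x = ∫ x, ψ x • gradient φ x :=
    setIntegral_eq_integral_of_forall_compl_eq_zero fun x hx => by
      rw [image_eq_zero_of_notMem_tsupport (fun h => hx (hψ.support_subset h)), zero_smul]
  rw [z1, z2]
  refine ext_inner_left ℝ fun e => ?_
  rw [inner_neg_right, ← integral_inner i1, ← integral_inner i2]
  have key := integral_mul_fderiv_eq_neg_fderiv_mul_of_integrable (μ := (volume : Measure (RN N)))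
    (f := φ) (g := ψ) (v := e) ?_ ?_ ?_
    (fun x _ => hφ.smooth.differentiable (by simp) x)
    (fun x _ => hψ.smooth.differentiable (by simp) x)
  · simpa [inner_smul_right, inner_gradient_right, mul_comm] using key
  · exact (i2.const_inner e).congr (Filter.Eventually.of_forall fun x => by
      simp [inner_smul_right, inner_gradient_right, mul_comm])
  · exact (i1.const_inner e).congr (Filter.Eventually.of_forall fun x => by
      simp [inner_smul_right, inner_gradient_right])
  · exact (hcφ.mul hcψ).integrable_of_hasCompactSupport hφ.compact.mul_right

theorem hasWeakGradient (u : H10 Ω) : HasWeakGradient Ω (fn u) (grad u) := by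
  intro φ hφ
  have m1 : MemLp (gradient φ) 2 (volume.restrict Ω) :=
    (gradient_continuous hφ).memLp_of_hasCompactSupport (gradient_compact hφ)
  have m2 : MemLp φ 2 (volume.restrict Ω) :=
    hφ.smooth.continuous.memLp_of_hasCompactSupport hφ.compact
  let A := (ContinuousLinearMap.lsmul ℝ ℝ (E := RN N)).lpPairing (volume.restrict Ω) 2 2
  let L : L2Pair Ω → RN N := fun p => A p.fst (m1.toLp) + A m2.toLp p.snd
  have hL : ∀ p : L2Pair Ω, L p =
      (∫ x in Ω, p.fst x • gradient φ x) + ∫ x in Ω, φ x • p.snd x := by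
    intro p
    simp only [L, A, ContinuousLinearMap.lpPairing_eq_integral, ContinuousLinearMap.lsmul_apply]
    congr 1
    · exact integral_congr_ae (by filter_upwards [m1.coeFn_toLp] with x hx; rw [hx])
    · exact integral_congr_ae (by filter_upwards [m2.coeFn_toLp] with x hx; rw [hx])
  have hLc : Continuous L := by
    have c1 : Continuous fun p : L2Pair Ω => p.fst := WithLp.continuous_fst ..
    have c2 : Continuous fun p : L2Pair Ω => p.snd := WithLp.continuous_snd ..
    exact (((A.flip m1.toLp).continuous).comp c1).add ((A m2.toLp).continuous.comp c2)
  have h0 : L u.1 = 0 := by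
    have hcl : IsClosed {p : L2Pair Ω | L p = 0} := isClosed_eq hLc continuous_const
    refine closure_minimal ?_ hcl u.2
    rintro p ⟨ψ, hψ, hp, hp'⟩
    have t := test_hasWeakGradient hψ φ hφ
    change L p = 0
    have e1 : ∫ x in Ω, p.fst x • gradient φ x = ∫ x in Ω, ψ x • gradient φ x :=
      integral_congr_ae (by filter_upwards [hp] with x hx; rw [hx])
    have e2 : ∫ x in Ω, φ x • p.snd x = ∫ x in Ω, φ x • gradient ψ x :=
      integral_congr_ae (by filter_upwards [hp'] with x hx; rw [hx])
    rw [hL, e1, e2, t, neg_add_cancel]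
  rw [hL] at h0
  exact eq_neg_of_add_eq_zero_left h0

end H10

/-- `V_u = {v ∈ H¹₀(Ω) ∩ L^∞(Ω) : u ∈ L^∞({v ≠ 0})}`. -/
def Vspace {N : ℕ} (Ω : Set (RN N)) (u : RN N → ℝ) : Set (H10 Ω) :=
  {v | MemLp (H10.fn v) ∞ (volume.restrict Ω) ∧
    MemLp u ∞ ((volume.restrict Ω).restrict {x | (H10.fn v) x ≠ 0})}

/-- The partial derivative `j_s(x, s, ξ)`. -/
def partialS {N : ℕ} (j : RN N → ℝ → RN N → ℝ) (x : RN N) (s : ℝ) (ξ : RN N) : ℝ :=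
  deriv (fun t => j x t ξ) s

/-- The gradient `j_ξ(x, s, ξ)` of `j` in its last variable. -/
def partialXi {N : ℕ} (j : RN N → ℝ → RN N → ℝ) (x : RN N) (s : ℝ) (ξ : RN N) : RN N :=
  gradient (fun ζ => j x s ζ) ξ

/-- `j(·, s, ξ)` is (Lebesgue) measurable on `Ω` for all `(s, ξ)`, and `j(x, ·, ·)` is of class `C¹`
for almost every `x ∈ Ω`. -/
structure IsC1Integrand {N : ℕ} (Ω : Set (RN N)) (j : RN N → ℝ → RN N → ℝ) : Prop where
  measurable : ∀ (s : ℝ) (ξ : RN N), AEMeasurable (fun x => j x s ξ) (volume.restrict Ω)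
  contDiff : ∀ᵐ x ∂(volume.restrict Ω), ContDiff ℝ 1 (fun p : ℝ × RN N => j x p.1 p.2)

/-- `|j_s(x, s, ξ)| ≤ γ(|s|) |ξ|²` and `|j_ξ(x, s, ξ)| ≤ μ(|s|) |ξ|`, with continuous
`γ, μ : [0, ∞) → [0, ∞)`. -/
def HasDerivGrowth {N : ℕ} (Ω : Set (RN N)) (j : RN N → ℝ → RN N → ℝ) : Prop :=
  ∃ γ μ : ℝ≥0 → ℝ≥0, Continuous γ ∧ Continuous μ ∧
    ∀ᵐ x ∂(volume.restrict Ω), ∀ (s : ℝ) (ξ : RN N),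
      |partialS j x s ξ| ≤ γ ‖s‖₊ * ‖ξ‖ ^ 2 ∧ ‖partialXi j x s ξ‖ ≤ μ ‖s‖₊ * ‖ξ‖

/-- The generalized sign condition: for some `ε ∈ (0, 1)` and `R ≥ 0`,
`(1 - ε) j_ξ(x, s, ξ) · ξ + j_s(x, s, ξ) s ≥ 0` whenever `|s| ≥ R`. -/
def SignCondition {N : ℕ} (Ω : Set (RN N)) (j : RN N → ℝ → RN N → ℝ) : Prop :=
  ∃ ε R : ℝ, 0 < ε ∧ ε < 1 ∧ 0 ≤ R ∧
    ∀ᵐ x ∂(volume.restrict Ω), ∀ (s : ℝ) (ξ : RN N), R ≤ |s| →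
      0 ≤ (1 - ε) * inner ℝ (partialXi j x s ξ) ξ + partialS j x s ξ * s

/-- The function `x ↦ j_ξ(x, u, ∇u) · ∇v`. -/
def xiTerm {N : ℕ} {Ω : Set (RN N)} (j : RN N → ℝ → RN N → ℝ) (u v : H10 Ω) (x : RN N) : ℝ :=
  inner ℝ (partialXi j x ((H10.fn u) x) ((H10.grad u) x)) ((H10.grad v) x)

/-- The function `x ↦ j_s(x, u, ∇u) v`. -/
def sTerm {N : ℕ} {Ω : Set (RN N)} (j : RN N → ℝ → RN N → ℝ) (u v : H10 Ω) (x : RN N) : ℝ :=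
  partialS j x ((H10.fn u) x) ((H10.grad u) x) * (H10.fn v) x

end

/-! The obstacle in (a) is that `v` need not be bounded, nor `u` bounded where `v` is nonzero. With
`m = n + 1`, the equation is tested with `z n = θ(u/m²) · m arctan(v/m)`, where `θ` is a smooth
cutoff. This is bounded and vanishes where `|u| > 2m²`, so it lies in `V_u`
(`H10.exists_truncation`, `mem_Vspace_of_bound`). Its gradient is `d n ∇u + a n ∇v` with `0 ≤ a n ≤
1` and `|d n| ≤ K/m`, and it equals `b n v` with `0 ≤ b n ≤ 1`. The term with `d n` disappears in
the limit because `j_ξ(x,u,∇u)·∇u` is integrable, and `z n → v` in `H¹₀` handles the right-hand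
side.

What remains is `∫ a n j_ξ·∇v + ∫ b n j_s v`, with both integrands at least `-|η|`. Fatou's lemma
applied to the sum makes the limits integrable; they then dominate their own truncations, and
dominated convergence gives the identity (`integrable_and_integral_add_eq_of_tendsto`).

For (b), the sign condition where `|u| ≥ R` and the growth condition where `|u| ≤ R` bound `j_s ζu`
below by an integrable function (`exists_integrable_le_sTerm`), so (a) applies to `ζu`.

Smooth `θ` and `arctan` are chosen so that the chain rule in `H¹₀`, a closure of test functions,
follows from the classical one by approximation (`H10.exists_mul_comp`). -/

open Filter Topology

/-! ### Limit passages in `L²` and `L¹`, and measurability of superpositions. -/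

section General

variable {α E : Type*} [MeasurableSpace α] {μ : Measure α} [NormedAddCommGroup E]

theorem tendsto_eLpNorm_two_of_dominated {f : ℕ → α → E} {g : α → E} {b : α → ℝ}
    (hf : ∀ n, AEStronglyMeasurable (f n) μ) (hb : MemLp b 2 μ)
    (hfb : ∀ n, ∀ᵐ x ∂μ, ‖f n x‖ ≤ b x)
    (hlim : ∀ᵐ x ∂μ, Tendsto (fun n => f n x) atTop (𝓝 (g x))) :
    Tendsto (fun n => eLpNorm (f n - g) 2 μ) atTop (𝓝 0) := by
  have hg : AEStronglyMeasurable g μ := aestronglyMeasurable_of_tendsto_ae _ hf hlim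
  have hall : ∀ᵐ x ∂μ, ∀ n, ‖f n x‖ ≤ b x := ae_all_iff.2 hfb
  have h2 : MemLp (fun x => b x + b x) 2 μ := hb.add hb
  have key : Tendsto (fun n => ∫⁻ x, ‖(f n - g) x‖ₑ ^ (2 : ℝ) ∂μ) atTop
      (𝓝 (∫⁻ _, 0 ∂μ)) := by
    refine tendsto_lintegral_of_dominated_convergence' (fun x => ‖b x + b x‖ₑ ^ (2 : ℝ))
      (fun n => ((hf n).sub hg).enorm.pow_const _) (fun n => ?_) ?_ ?_
    · filter_upwards [hall, hlim] with x hx hl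
      have hgx : ‖g x‖ ≤ b x := le_of_tendsto hl.norm (Eventually.of_forall hx)
      refine ENNReal.rpow_le_rpow (enorm_le_iff_norm_le.2 ?_) (by norm_num)
      exact (norm_sub_le _ _).trans ((add_le_add (hx n) hgx).trans (le_abs_self _))
    · have := h2.eLpNorm_lt_top
      rw [eLpNorm_lt_top_iff_lintegral_rpow_enorm_lt_top (by norm_num) (by norm_num)] at this
      simpa using this.ne
    · filter_upwards [hlim] with x hl
      have h0 : Tendsto (fun n => f n x - g x) atTop (𝓝 0) := by
        simpa using hl.sub_const (g x)
      have h1 := h0.enorm.ennrpow_const 2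
      simpa using h1
  simp_rw [eLpNorm_eq_lintegral_rpow_enorm_toReal (p := 2) (by norm_num) (by norm_num)]
  simpa using key.ennrpow_const (1 / 2)

/-- Split `c n • f n - d • g = c n • (f n - g) + (c n - d) • g`: the first part is controlled by the
uniform bound `C`, the second by dominated convergence. Hence a.e. convergence of the coefficients
is enough. -/
theorem tendsto_eLpNorm_two_smul [NormedSpace ℝ E] {c : ℕ → α → ℝ} {d : α → ℝ}
    {f : ℕ → α → E} {g : α → E} {C : ℝ}
    (hc : ∀ n, AEStronglyMeasurable (c n) μ) (hcb : ∀ n x, |c n x| ≤ C)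
    (hcd : ∀ᵐ x ∂μ, Tendsto (fun n => c n x) atTop (𝓝 (d x)))
    (hf : ∀ n, AEStronglyMeasurable (f n) μ) (hg : MemLp g 2 μ)
    (hfg : Tendsto (fun n => eLpNorm (f n - g) 2 μ) atTop (𝓝 0)) :
    Tendsto (fun n => eLpNorm (c n • f n - d • g) 2 μ) atTop (𝓝 0) := by
  have h1 : Tendsto (fun n => eLpNorm (c n • g - d • g) 2 μ) atTop (𝓝 0) := by
    refine tendsto_eLpNorm_two_of_dominated (b := fun x => C * ‖g x‖)
      (fun n => (hc n).smul hg.1) (hg.norm.const_mul C) (fun n => ?_) ?_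
    · refine Eventually.of_forall fun x => ?_
      rw [Pi.smul_apply', norm_smul]
      exact mul_le_mul_of_nonneg_right (hcb n x) (norm_nonneg _)
    · filter_upwards [hcd] with x hx
      exact hx.smul_const _
  have h2 : Tendsto (fun n => ENNReal.ofReal C * eLpNorm (f n - g) 2 μ) atTop (𝓝 0) := by
    simpa using ENNReal.Tendsto.const_mul hfg (Or.inr ENNReal.ofReal_ne_top)
  have h3 := h2.add h1
  rw [add_zero] at h3
  refine tendsto_of_tendsto_of_tendsto_of_le_of_le tendsto_const_nhds h3 (fun _ => zero_le)
    fun n => ?_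
  have e : c n • f n - d • g = c n • (f n - g) + (c n • g - d • g) := by
    rw [smul_sub]; abel
  change eLpNorm (c n • f n - d • g) 2 μ ≤ _
  rw [e]
  have hd : AEStronglyMeasurable d μ := aestronglyMeasurable_of_tendsto_ae _ hc hcd
  refine (eLpNorm_add_le ((hc n).smul ((hf n).sub hg.1))
    (((hc n).smul hg.1).sub (hd.smul hg.1)) (by norm_num)).trans (add_le_add_left ?_ _)
  refine eLpNorm_le_mul_eLpNorm_of_ae_le_mul (Eventually.of_forall fun x => ?_) 2
  rw [Pi.smul_apply', norm_smul]
  exact mul_le_mul_of_nonneg_right (hcb n x) (norm_nonneg _)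

/-- A Brezis–Browder type limit passage: Fatou's lemma gives the integrability of the limits of two
sequences bounded below, and dominated convergence the limit of the integrals. -/
theorem integrable_and_integral_add_eq_of_tendsto {F G η : α → ℝ} {f g : ℕ → α → ℝ} {l : ℝ}
    (hη : Integrable η μ) (hf : ∀ n, Integrable (f n) μ) (hg : ∀ n, Integrable (g n) μ)
    (hfη : ∀ n, ∀ᵐ x ∂μ, -|η x| ≤ f n x) (hgη : ∀ n, ∀ᵐ x ∂μ, -|η x| ≤ g n x)
    (hfF : ∀ n, ∀ᵐ x ∂μ, |f n x| ≤ |F x|) (hgG : ∀ n, ∀ᵐ x ∂μ, |g n x| ≤ |G x|)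
    (hfl : ∀ᵐ x ∂μ, Tendsto (fun n => f n x) atTop (𝓝 (F x)))
    (hgl : ∀ᵐ x ∂μ, Tendsto (fun n => g n x) atTop (𝓝 (G x)))
    (hl : Tendsto (fun n => (∫ x, f n x ∂μ) + ∫ x, g n x ∂μ) atTop (𝓝 l)) :
    Integrable F μ ∧ Integrable G μ ∧ (∫ x, F x ∂μ) + ∫ x, G x ∂μ = l := by
  have hFm : AEStronglyMeasurable F μ := aestronglyMeasurable_of_tendsto_ae _ (fun n => (hf n).1) hfl
  have hGm : AEStronglyMeasurable G μ := aestronglyMeasurable_of_tendsto_ae _ (fun n => (hg n).1) hgl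
  have hF : ∀ᵐ x ∂μ, -|η x| ≤ F x := by
    filter_upwards [hfl, ae_all_iff.2 hfη] with x h1 h2
    exact ge_of_tendsto h1 (Eventually.of_forall h2)
  have hG : ∀ᵐ x ∂μ, -|η x| ≤ G x := by
    filter_upwards [hgl, ae_all_iff.2 hgη] with x h1 h2
    exact ge_of_tendsto h1 (Eventually.of_forall h2)
  have hηa : Integrable (fun x => 2 * |η x|) μ := hη.abs.const_mul 2
  have hi : ∀ n, Integrable (fun x => f n x + g n x) μ := fun n => (hf n).add (hg n)
  have hH : ∀ n, Integrable (fun x => f n x + g n x + 2 * |η x|) μ := fun n => (hi n).add hηa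
  -- Adding `2|η|` makes the sums nonnegative, so their `L¹` norms are their integrals, eventually
  -- at most `l + 1 + ∫ 2|η|`; Fatou carries the bound to the limit.
  have hS : Integrable (fun x => F x + G x + 2 * |η x|) μ := by
    refine memLp_one_iff_integrable.1 ⟨(hFm.add hGm).add hηa.1, ?_⟩
    refine lt_of_le_of_lt (Lp.eLpNorm_le_of_ae_tendsto (u := atTop)
      (f := fun n x => f n x + g n x + 2 * |η x|)
      (C := ENNReal.ofReal (l + 1 + ∫ x, 2 * |η x| ∂μ)) ?_
      (fun n => (hH n).1) ?_) ENNReal.ofReal_lt_top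
    · filter_upwards [hl.eventually (gt_mem_nhds (lt_add_one l))] with n hn
      rw [eLpNorm_one_eq_lintegral_enorm, ← ofReal_integral_norm_eq_lintegral_enorm (hH n)]
      refine ENNReal.ofReal_le_ofReal ?_
      have : ∫ x, ‖f n x + g n x + 2 * |η x|‖ ∂μ = ∫ x, f n x + g n x + 2 * |η x| ∂μ := by
        refine integral_congr_ae ?_
        filter_upwards [hfη n, hgη n] with x h1 h2
        rw [Real.norm_of_nonneg (by linarith)]
      rw [this, integral_add (hi n) hηa, integral_add (hf n) (hg n)]
      linarith
    · filter_upwards [hfl, hgl] with x h1 h2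
      exact (h1.add h2).add_const _
  -- The lower bound on `G` turns the integrable sum into an upper bound for `F`.
  have hFi : Integrable F μ := by
    refine (hS.add hη.abs).mono' hFm ?_
    filter_upwards [hF, hG] with x h1 h2
    simp only [Pi.add_apply, Real.norm_eq_abs]
    rw [abs_le]
    constructor <;> linarith [abs_nonneg (η x)]
  have hGi : Integrable G μ := by
    refine (hS.add hη.abs).mono' hGm ?_
    filter_upwards [hF, hG] with x h1 h2
    simp only [Pi.add_apply, Real.norm_eq_abs]
    rw [abs_le]
    constructor <;> linarith [abs_nonneg (η x)]
  refine ⟨hFi, hGi, tendsto_nhds_unique ?_ hl⟩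
  exact (tendsto_integral_of_dominated_convergence _ (fun n => (hf n).1) hFi.abs hfF hfl).add
    (tendsto_integral_of_dominated_convergence _ (fun n => (hg n).1) hGi.abs hgG hgl)

/-- The Carathéodory argument: along a simple function the superposition is a finite sum of
indicators, and continuity in the second variable passes to the limit. -/
theorem aemeasurable_comp_of_continuous {X : Type*} [TopologicalSpace X]
    [TopologicalSpace.PseudoMetrizableSpace X]
    {f : α → X → ℝ} (hf : ∀ p, AEMeasurable (fun x => f x p) μ)
    (hc : ∀ᵐ x ∂μ, Continuous (f x)) {p : α → X} (hp : StronglyMeasurable p) :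
    AEMeasurable (fun x => f x (p x)) μ := by
  classical
  refine aemeasurable_of_tendsto_metrizable_ae atTop (f := fun n x => f x (hp.approx n x))
    (fun n => ?_) ?_
  · have e : (fun x => f x (hp.approx n x)) = fun x => ∑ c ∈ (hp.approx n).range,
        (hp.approx n ⁻¹' {c}).indicator (fun y => f y c) x := by
      funext x
      rw [Finset.sum_eq_single (hp.approx n x)]
      · rw [Set.indicator_of_mem (by simp)]
      · intro c _ hcx
        exact Set.indicator_of_notMem (fun h => hcx (by simpa using h.symm)) _
      · exact fun h => absurd (SimpleFunc.mem_range_self _ _) h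
    rw [e]
    exact Finset.aemeasurable_fun_sum _ fun c _ =>
      (hf c).indicator ((hp.approx n).measurableSet_fiber c)
  · filter_upwards [hc] with x hx
    exact (hx.tendsto _).comp (hp.tendsto_approx x)

end General

/-! ### Convergence and the chain rule in `H¹₀(Ω)`. -/

namespace H10

variable {N : ℕ} {Ω : Set (RN N)}

lemma memLp_fn (u : H10 Ω) : MemLp (fn u) 2 (volume.restrict Ω) := Lp.memLp _

lemma memLp_grad (u : H10 Ω) : MemLp (grad u) 2 (volume.restrict Ω) := Lp.memLp _

lemma stronglyMeasurable_fn (u : H10 Ω) : StronglyMeasurable (fn u) := Lp.stronglyMeasurable _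

lemma stronglyMeasurable_grad (u : H10 Ω) : StronglyMeasurable (grad u) :=
  Lp.stronglyMeasurable _

/-- Convergence in `H¹₀(Ω)` is the `L²` convergence of the functions and of their gradients. -/
theorem tendsto_L2Pair {ι : Type*} {l : Filter ι} {p : ι → L2Pair Ω} {q : L2Pair Ω} :
    Tendsto p l (𝓝 q) ↔
      Tendsto (fun i => eLpNorm (⇑(p i).fst - ⇑q.fst) 2 (volume.restrict Ω)) l (𝓝 0) ∧
      Tendsto (fun i => eLpNorm (⇑(p i).snd - ⇑q.snd) 2 (volume.restrict Ω)) l (𝓝 0) := by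
  rw [← Lp.tendsto_Lp_iff_tendsto_eLpNorm', ← Lp.tendsto_Lp_iff_tendsto_eLpNorm']
  constructor
  · intro h
    exact ⟨((WithLp.continuous_fst 2 _ _).tendsto _).comp h,
      ((WithLp.continuous_snd 2 _ _).tendsto _).comp h⟩
  · rintro ⟨h1, h2⟩
    exact ((WithLp.prod_continuous_toLp 2 _ _).tendsto (q.fst, q.snd)).comp (h1.prodMk_nhds h2)

theorem tendsto_iff {ι : Type*} {l : Filter ι} {z : ι → H10 Ω} {v : H10 Ω} :
    Tendsto z l (𝓝 v) ↔
      Tendsto (fun i => eLpNorm (fn (z i) - fn v) 2 (volume.restrict Ω)) l (𝓝 0) ∧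
      Tendsto (fun i => eLpNorm (grad (z i) - grad v) 2 (volume.restrict Ω)) l (𝓝 0) := by
  rw [tendsto_subtype_rng]
  exact tendsto_L2Pair

/-- Approximation by test functions, with almost everywhere convergence of the functions. -/
theorem exists_testFunction_tendsto (u : H10 Ω) : ∃ φ : ℕ → RN N → ℝ,
    (∀ n, IsTestFunction Ω (φ n)) ∧
    (∀ᵐ x ∂(volume.restrict Ω), Tendsto (fun n => φ n x) atTop (𝓝 (fn u x))) ∧
    Tendsto (fun n => eLpNorm (gradient (φ n) - grad u) 2 (volume.restrict Ω)) atTop (𝓝 0) := by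
  obtain ⟨p, hp, hpu⟩ := mem_closure_iff_seq_limit.1 u.2
  choose φ hφ h1 h2 using hp
  obtain ⟨c1, c2⟩ := tendsto_L2Pair.1 hpu
  have hm := tendstoInMeasure_of_tendsto_eLpNorm (by norm_num)
    (fun n => (Lp.memLp (p n).fst).1) (memLp_fn u).1 c1
  obtain ⟨k, hk, hae⟩ := hm.exists_seq_tendsto_ae
  refine ⟨fun n => φ (k n), fun n => hφ _, ?_, ?_⟩
  · filter_upwards [hae, ae_all_iff.2 h1] with x hx hx1
    simpa only [hx1] using hx
  · refine (c2.comp hk.tendsto_atTop).congr fun n => ?_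
    exact eLpNorm_congr_ae ((h2 (k n)).sub EventuallyEq.rfl)

theorem exists_of_tendsto {χ : ℕ → RN N → ℝ} (hχ : ∀ n, IsTestFunction Ω (χ n))
    {f : RN N → ℝ} {F : RN N → RN N} (hf : MemLp f 2 (volume.restrict Ω))
    (hF : MemLp F 2 (volume.restrict Ω))
    (h1 : Tendsto (fun n => eLpNorm (χ n - f) 2 (volume.restrict Ω)) atTop (𝓝 0))
    (h2 : Tendsto (fun n => eLpNorm (gradient (χ n) - F) 2 (volume.restrict Ω)) atTop (𝓝 0)) :
    ∃ z : H10 Ω, fn z =ᵐ[volume.restrict Ω] f ∧ grad z =ᵐ[volume.restrict Ω] F := by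
  have m1 : ∀ n, MemLp (χ n) 2 (volume.restrict Ω) := fun n =>
    (hχ n).smooth.continuous.memLp_of_hasCompactSupport (hχ n).compact
  have m2 : ∀ n, MemLp (gradient (χ n)) 2 (volume.restrict Ω) := fun n =>
    (gradient_continuous (hχ n)).memLp_of_hasCompactSupport (gradient_compact (hχ n))
  refine ⟨⟨WithLp.toLp 2 (hf.toLp f, hF.toLp F), ?_⟩, hf.coeFn_toLp, hF.coeFn_toLp⟩
  refine mem_closure_of_tendsto (b := atTop)
    (f := fun n => (WithLp.toLp 2 ((m1 n).toLp (χ n), (m2 n).toLp (gradient (χ n))) : L2Pair Ω))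
    ?_ (Eventually.of_forall fun n => ⟨χ n, hχ n, (m1 n).coeFn_toLp, (m2 n).coeFn_toLp⟩)
  refine tendsto_L2Pair.2 ⟨h1.congr fun n => ?_, h2.congr fun n => ?_⟩
  · exact eLpNorm_congr_ae ((m1 n).coeFn_toLp.sub hf.coeFn_toLp).symm
  · exact eLpNorm_congr_ae ((m2 n).coeFn_toLp.sub hF.coeFn_toLp).symm

/-- The factor `τ (ψ x)` alone confines the support, so `θ 0` may be nonzero, as it is for the
cutoff. -/
lemma isTestFunction_mul_comp {θ τ : ℝ → ℝ} (hθ : ContDiff ℝ ∞ θ) (hτ : ContDiff ℝ ∞ τ)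
    (hτ0 : τ 0 = 0) {φ ψ : RN N → ℝ} (hφ : IsTestFunction Ω φ) (hψ : IsTestFunction Ω ψ) :
    IsTestFunction Ω fun x => θ (φ x) * τ (ψ x) where
  smooth := (hθ.comp hφ.smooth).mul (hτ.comp hψ.smooth)
  compact := (hψ.compact.comp_left (g := τ) hτ0).mul_left
  support_subset := ((tsupport_mul_subset_right).trans
    (closure_mono (Function.support_comp_subset hτ0 ψ))).trans hψ.support_subset

lemma gradient_mul_comp {θ τ : ℝ → ℝ} (hθ : ContDiff ℝ ∞ θ) (hτ : ContDiff ℝ ∞ τ)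
    {φ ψ : RN N → ℝ} (hφ : IsTestFunction Ω φ) (hψ : IsTestFunction Ω ψ) :
    gradient (fun x => θ (φ x) * τ (ψ x)) =
      (fun x => deriv θ (φ x) * τ (ψ x)) • gradient φ +
      (fun x => θ (φ x) * deriv τ (ψ x)) • gradient ψ := by
  funext x
  refine ext_inner_right ℝ fun e => ?_
  have dφ := (hφ.smooth.differentiable (by simp) x).hasFDerivAt
  have dψ := (hψ.smooth.differentiable (by simp) x).hasFDerivAt
  have dθ := (hθ.differentiable (by simp) (φ x)).hasDerivAt.comp_hasFDerivAt x dφ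
  have dτ := (hτ.differentiable (by simp) (ψ x)).hasDerivAt.comp_hasFDerivAt x dψ
  have d := (dθ.mul dτ).fderiv
  change fderiv ℝ (fun x => θ (φ x) * τ (ψ x)) x = _ at d
  simp only [inner_gradient_left, d, Pi.add_apply, Pi.smul_apply', inner_add_left,
    real_inner_smul_left]
  simp
  ring

/-- The chain and product rules for `θ(u) τ(v)` in `H¹₀(Ω)`. -/
theorem exists_mul_comp [IsFiniteMeasure (volume.restrict Ω)] {θ τ : ℝ → ℝ}
    (hθ : ContDiff ℝ ∞ θ) (hτ : ContDiff ℝ ∞ τ) (hτ0 : τ 0 = 0) {C : ℝ}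
    (bθ : ∀ s, |θ s| ≤ C) (bτ : ∀ s, |τ s| ≤ C) (bθ' : ∀ s, |deriv θ s| ≤ C)
    (bτ' : ∀ s, |deriv τ s| ≤ C) (u v : H10 Ω) :
    ∃ z : H10 Ω, fn z =ᵐ[volume.restrict Ω] (fun x => θ (fn u x) * τ (fn v x)) ∧
      grad z =ᵐ[volume.restrict Ω] fun x => (deriv θ (fn u x) * τ (fn v x)) • grad u x +
        (θ (fn u x) * deriv τ (fn v x)) • grad v x := by
  obtain ⟨φ, hφ, φu, φu'⟩ := exists_testFunction_tendsto u
  obtain ⟨ψ, hψ, ψv, ψv'⟩ := exists_testFunction_tendsto v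
  have cθ' : Continuous (deriv θ) := hθ.continuous_deriv (by simp)
  have cτ' : Continuous (deriv τ) := hτ.continuous_deriv (by simp)
  have C0 : 0 ≤ C := (abs_nonneg _).trans (bθ 0)
  have bound : ∀ {f g : ℝ → ℝ}, (∀ s, |f s| ≤ C) → (∀ s, |g s| ≤ C) → ∀ s t, |f s * g t| ≤ C * C :=
    fun hf hg s t => by
      rw [abs_mul]; exact mul_le_mul (hf s) (hg t) (abs_nonneg _) C0
  have mt : ∀ {f g : ℝ → ℝ}, Continuous f → Continuous g → ∀ n,
      AEStronglyMeasurable (fun x => f (φ n x) * g (ψ n x)) (volume.restrict Ω) :=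
    fun hf hg n => ((hf.comp (hφ n).smooth.continuous).mul
      (hg.comp (hψ n).smooth.continuous)).aestronglyMeasurable
  have ml : ∀ {f g : ℝ → ℝ}, Continuous f → Continuous g →
      AEStronglyMeasurable (fun x => f (fn u x) * g (fn v x)) (volume.restrict Ω) :=
    fun hf hg => ((hf.comp_stronglyMeasurable (stronglyMeasurable_fn u)).mul
      (hg.comp_stronglyMeasurable (stronglyMeasurable_fn v))).aestronglyMeasurable
  have lim : ∀ {f g : ℝ → ℝ}, Continuous f → Continuous g → ∀ᵐ x ∂(volume.restrict Ω),
      Tendsto (fun n => f (φ n x) * g (ψ n x)) atTop (𝓝 (f (fn u x) * g (fn v x))) :=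
    fun hf hg => by
      filter_upwards [φu, ψv] with x hx hx'
      exact ((hf.tendsto _).comp hx).mul ((hg.tendsto _).comp hx')
  have l2 : ∀ {f g : ℝ → ℝ} (w : H10 Ω), Continuous f → Continuous g → (∀ s, |f s| ≤ C) →
      (∀ s, |g s| ≤ C) →
      MemLp (fun x => (f (fn u x) * g (fn v x)) • grad w x) 2 (volume.restrict Ω) :=
    fun w hf hg bf bg => (memLp_grad w).of_le_mul (c := C * C)
      ((ml hf hg).smul (memLp_grad w).1) (Eventually.of_forall fun x => by
        rw [norm_smul]; exact mul_le_mul_of_nonneg_right (bound bf bg _ _) (norm_nonneg _))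
  have gm : ∀ {φ : ℕ → RN N → ℝ}, (∀ n, IsTestFunction Ω (φ n)) → ∀ n,
      AEStronglyMeasurable (gradient (φ n)) (volume.restrict Ω) :=
    fun h n => (gradient_continuous (h n)).aestronglyMeasurable
  refine exists_of_tendsto (fun n => isTestFunction_mul_comp hθ hτ hτ0 (hφ n) (hψ n))
    ?_ ((l2 u cθ' hτ.continuous bθ' bτ).add (l2 v hθ.continuous cτ' bθ bτ')) ?_ ?_
  -- Finite measure makes the constant `C * C` square integrable, hence a dominating function.
  · exact MemLp.of_bound (ml hθ.continuous hτ.continuous) (C * C)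
      (Eventually.of_forall fun x => bound bθ bτ _ _)
  · exact tendsto_eLpNorm_two_of_dominated (b := fun _ => C * C) (mt hθ.continuous hτ.continuous)
      (memLp_const _) (fun n => Eventually.of_forall fun x => bound bθ bτ _ _)
      (lim hθ.continuous hτ.continuous)
  · have t1 := tendsto_eLpNorm_two_smul (mt cθ' hτ.continuous)
      (fun n x => bound bθ' bτ _ _) (lim cθ' hτ.continuous) (gm hφ) (memLp_grad u) φu'
    have t2 := tendsto_eLpNorm_two_smul (mt hθ.continuous cτ')
      (fun n x => bound bθ bτ' _ _) (lim hθ.continuous cτ') (gm hψ) (memLp_grad v) ψv'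
    have t := t1.add t2
    rw [add_zero] at t
    refine tendsto_of_tendsto_of_tendsto_of_le_of_le tendsto_const_nhds t (fun _ => zero_le)
      fun n => ?_
    dsimp only
    rw [gradient_mul_comp hθ hτ (hφ n) (hψ n)]
    refine le_trans (le_of_eq ?_) (eLpNorm_add_le
      (((mt cθ' hτ.continuous n).smul (gm hφ n)).sub (l2 u cθ' hτ.continuous bθ' bτ).1)
      (((mt hθ.continuous cτ' n).smul (gm hψ n)).sub (l2 v hθ.continuous cτ' bθ bτ').1)
      (by norm_num))
    rw [← add_sub_add_comm]
    rfl

end H10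

/-! ### The one-variable cutoff and the bounds on `arctan`. -/

theorem exists_smooth_cutoff : ∃ (θ : ℝ → ℝ) (C : ℝ), ContDiff ℝ ∞ θ ∧ (∀ s, 0 ≤ θ s) ∧
    (∀ s, θ s ≤ 1) ∧ (∀ s, |s| ≤ 1 → θ s = 1) ∧ (∀ s, θ s ≠ 0 → |s| ≤ 2) ∧
    ∀ s, |deriv θ s| ≤ C := by
  let f : ContDiffBump (0 : ℝ) := ⟨1, 2, one_pos, one_lt_two⟩
  have hf : ContDiff ℝ ∞ f := f.contDiff
  obtain ⟨C, hC⟩ := (hf.continuous_deriv (by simp)).bounded_above_of_compact_support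
    f.hasCompactSupport.deriv
  refine ⟨f, C, hf, fun s => f.nonneg, fun s => f.le_one, fun s hs =>
    f.one_of_mem_closedBall (by simpa [f] using hs), fun s hs => ?_, hC⟩
  by_contra! h
  exact hs (f.zero_of_le_dist (by simpa [f] using h.le))

theorem Real.abs_arctan_le_abs (x : ℝ) : |Real.arctan x| ≤ |x| := by
  have h := Convex.norm_image_sub_le_of_norm_deriv_le (f := Real.arctan) (C := 1)
    (s := Set.univ) (x := 0) (y := x) (fun y _ => Real.differentiable_arctan y) (fun y _ => ?_)
    convex_univ trivial trivial
  · simpa using h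
  · rw [Real.deriv_arctan, Real.norm_of_nonneg (by positivity)]
    exact div_le_one_of_le₀ (by nlinarith [sq_nonneg y]) (by positivity)

theorem Real.arctan_div_self_mem_Icc (x : ℝ) : 0 ≤ Real.arctan x / x ∧ Real.arctan x / x ≤ 1 := by
  constructor
  · rcases le_total 0 x with h | h
    · exact div_nonneg (Real.arctan_nonneg.2 h) h
    · exact div_nonneg_of_nonpos (Real.arctan_le_zero.2 h) h
  · refine (le_abs_self _).trans ?_
    rw [abs_div]
    exact div_le_one_of_le₀ (Real.abs_arctan_le_abs x) (abs_nonneg x)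

theorem Real.abs_arctan_le_two (x : ℝ) : |Real.arctan x| ≤ 2 := by
  have := Real.pi_lt_four
  rw [abs_le]
  constructor <;> linarith [Real.arctan_lt_pi_div_two x, Real.neg_pi_div_two_lt_arctan x]

/-- For `t ≠ 0` the expression is `t` times the slope of `arctan` between `0` and `t / c n`, and
`arctan` has derivative `1` at `0`. -/
theorem tendsto_mul_arctan_div (t : ℝ) {c : ℕ → ℝ} (hc : ∀ n, 0 < c n) (hct : Tendsto c atTop atTop) :
    Tendsto (fun n => c n * Real.arctan (t / c n)) atTop (𝓝 t) := by
  rcases eq_or_ne t 0 with rfl | ht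
  · simp
  have h := hasDerivAt_iff_tendsto_slope.1 (Real.hasDerivAt_arctan 0)
  have h0 : Tendsto (fun n => t / c n) atTop (𝓝[≠] 0) :=
    tendsto_nhdsWithin_iff.2 ⟨hct.const_div_atTop t,
      Eventually.of_forall fun n => div_ne_zero ht (hc n).ne'⟩
  have h1 := (h.comp h0).const_mul t
  simp only [ne_eq, OfNat.ofNat_ne_zero, not_false_eq_true, zero_pow, add_zero, div_one,
    mul_one] at h1
  refine h1.congr fun n => ?_
  have := (hc n).ne'
  simp [slope_def_field]
  field_simp

theorem tendsto_natCast_add_one_atTop : Tendsto (fun n : ℕ => (n : ℝ) + 1) atTop atTop :=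
  tendsto_atTop_add_const_right _ _ tendsto_natCast_atTop_atTop

/-! ### Admissible truncations. -/

namespace H10

variable {N : ℕ} {Ω : Set (RN N)}

/-- Bounded truncations of `v` whose supports lie in sets where `u` is bounded: they are the
functions `θ(u / m²) m arctan(v / m)`, `m = n + 1`, for a smooth cutoff function `θ`. -/
theorem exists_truncation [IsFiniteMeasure (volume.restrict Ω)] (u v : H10 Ω) :
    ∃ (z : ℕ → H10 Ω) (a b d : ℕ → RN N → ℝ) (R : ℕ → ℝ) (K : ℝ),
      (∀ n, Measurable (a n)) ∧ (∀ n, Measurable (b n)) ∧ (∀ n, Measurable (d n)) ∧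
      (∀ n x, 0 ≤ a n x ∧ a n x ≤ 1) ∧ (∀ n x, 0 ≤ b n x ∧ b n x ≤ 1) ∧
      (∀ n x, |d n x| ≤ K / (n + 1)) ∧
      (∀ n x, a n x ≠ 0 → |fn u x| ≤ R n) ∧ (∀ n x, b n x ≠ 0 → |fn u x| ≤ R n) ∧
      (∀ n x, |b n x * fn v x| ≤ R n) ∧
      (∀ x, Tendsto (fun n => a n x) atTop (𝓝 1)) ∧
      (∀ x, Tendsto (fun n => b n x * fn v x) atTop (𝓝 (fn v x))) ∧
      (∀ n, fn (z n) =ᵐ[volume.restrict Ω] fun x => b n x * fn v x) ∧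
      ∀ n, grad (z n) =ᵐ[volume.restrict Ω] fun x => d n x • grad u x + a n x • grad v x := by
  obtain ⟨θ, C, hθ, θ0, θ1, θeq, θsupp, hC⟩ := exists_smooth_cutoff
  have C0 : 0 ≤ C := (abs_nonneg _).trans (hC 0)
  have cθ' : Continuous (deriv θ) := hθ.continuous_deriv (by simp)
  have mu : Measurable (fn u) := (stronglyMeasurable_fn u).measurable
  have mv : Measurable (fn v) := (stronglyMeasurable_fn v).measurable
  let c : ℕ → ℝ := fun n => n + 1
  have c1 : ∀ n, 1 ≤ c n := fun n => by simp [c]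
  have cpos : ∀ n, 0 < c n := fun n => one_pos.trans_le (c1 n)
  have ct : Tendsto c atTop atTop := tendsto_natCast_add_one_atTop
  -- The scale for `u` is the square of the scale for `v`: differentiating the cutoff gains `1 / c n
  -- ^ 2`, the truncated `v` costs `2 * c n`, and the product still tends to zero.
  have c2 : ∀ n, 0 < c n ^ 2 := fun n => pow_pos (cpos n) 2
  have dθ : ∀ n s, HasDerivAt (fun s => θ (s / c n ^ 2)) (deriv θ (s / c n ^ 2) / c n ^ 2) s := by
    intro n s
    have := ((hθ.differentiable (by simp) (s / c n ^ 2)).hasDerivAt).comp s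
      ((hasDerivAt_id s).div_const (c n ^ 2))
    simpa [div_eq_mul_inv, Function.comp_def] using this
  have dτ : ∀ n t, HasDerivAt (fun t => c n * Real.arctan (t / c n))
      (1 / (1 + (t / c n) ^ 2)) t := by
    intro n t
    have := (((Real.hasDerivAt_arctan (t / c n)).comp t
      ((hasDerivAt_id t).div_const (c n)))).const_mul (c n)
    rwa [mul_left_comm, mul_one_div_cancel (cpos n).ne', mul_one] at this
  have A1 : ∀ t : ℝ, 0 ≤ 1 / (1 + t ^ 2) ∧ 1 / (1 + t ^ 2) ≤ 1 := fun t =>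
    ⟨by positivity, div_le_one_of_le₀ (by nlinarith [sq_nonneg t]) (by positivity)⟩
  have bτ : ∀ n t, |c n * Real.arctan (t / c n)| ≤ c n * 2 := fun n t => by
    rw [abs_mul, abs_of_pos (cpos n)]
    exact mul_le_mul_of_nonneg_left (Real.abs_arctan_le_two _) (cpos n).le
  have bθ' : ∀ n s, |deriv θ (s / c n ^ 2) / c n ^ 2| ≤ C / c n ^ 2 := fun n s => by
    rw [abs_div, abs_of_pos (c2 n)]
    exact div_le_div_of_nonneg_right (hC _) (c2 n).le
  have ex : ∀ n, ∃ z : H10 Ω, fn z =ᵐ[volume.restrict Ω]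
      (fun x => θ (fn u x / c n ^ 2) * (c n * Real.arctan (fn v x / c n))) ∧
      grad z =ᵐ[volume.restrict Ω] fun x =>
        (deriv θ (fn u x / c n ^ 2) / c n ^ 2 * (c n * Real.arctan (fn v x / c n))) • grad u x +
        (θ (fn u x / c n ^ 2) * (1 / (1 + (fn v x / c n) ^ 2))) • grad v x := by
    intro n
    -- One constant has to dominate both functions and both derivatives, whose bounds are `1`, `c n
    -- * 2`, `C` and `1`.
    have h := exists_mul_comp (Ω := Ω) (θ := fun s => θ (s / c n ^ 2))
      (τ := fun t => c n * Real.arctan (t / c n)) (C := 1 + c n * 2 + C)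
      (hθ.comp (contDiff_id.div_const _))
      (contDiff_const.mul (Real.contDiff_arctan.comp (contDiff_id.div_const _))) (by simp)
      ?_ ?_ ?_ ?_ u v
    · simpa only [(dθ n _).deriv, (dτ n _).deriv] using h
    · intro s
      rw [abs_of_nonneg (θ0 _)]
      linarith [θ1 (s / c n ^ 2), cpos n]
    · intro s
      linarith [bτ n s]
    · intro s
      rw [(dθ n s).deriv]
      have : C / c n ^ 2 ≤ C := div_le_self C0 (one_le_pow₀ (c1 n))
      linarith [bθ' n s, cpos n]
    · intro s
      rw [(dτ n s).deriv, abs_of_nonneg (A1 _).1]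
      linarith [(A1 (s / c n)).2, cpos n]
  choose z hz hz' using ex
  have θsupp' : ∀ n x, θ (fn u x / c n ^ 2) ≠ 0 → |fn u x| ≤ 2 * c n ^ 2 := by
    intro n x h
    have := θsupp _ h
    rwa [abs_div, abs_of_pos (c2 n), div_le_iff₀ (c2 n)] at this
  -- A single radius serves for `|u|` on the support (`2 * c n ^ 2`) and for the truncated `v` (`c n
  -- * 2`).
  have R1 : ∀ n, 2 * c n ^ 2 ≤ 2 * c n ^ 2 + c n * 2 := fun n => by linarith [cpos n]
  -- Where `v = 0` the quotient is `0` by convention, so `b n` need not tend to `1`; only the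
  -- product `b n * v` is used in the limit.
  have be : ∀ n x, θ (fn u x / c n ^ 2) * (Real.arctan (fn v x / c n) / (fn v x / c n)) * fn v x =
      θ (fn u x / c n ^ 2) * (c n * Real.arctan (fn v x / c n)) := by
    intro n x
    have := (cpos n).ne'
    rcases eq_or_ne (fn v x) 0 with h | h
    · simp [h]
    · field_simp
  have θlim : ∀ x, Tendsto (fun n => θ (fn u x / c n ^ 2)) atTop (𝓝 1) := by
    intro x
    have h0 : Tendsto (fun n => fn u x / c n ^ 2) atTop (𝓝 0) :=
      ((tendsto_pow_atTop two_ne_zero).comp ct).const_div_atTop _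
    have := (hθ.continuous.tendsto 0).comp h0
    rwa [θeq 0 (by simp)] at this
  refine ⟨z, fun n x => θ (fn u x / c n ^ 2) * (1 / (1 + (fn v x / c n) ^ 2)),
    fun n x => θ (fn u x / c n ^ 2) * (Real.arctan (fn v x / c n) / (fn v x / c n)),
    fun n x => deriv θ (fn u x / c n ^ 2) / c n ^ 2 * (c n * Real.arctan (fn v x / c n)),
    fun n => 2 * c n ^ 2 + c n * 2, C * 2, fun n => ?_, fun n => ?_, fun n => ?_, fun n x => ?_,
    fun n x => ?_, fun n x => ?_, fun n x h => ?_, fun n x h => ?_, fun n x => ?_, fun x => ?_,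
    fun x => ?_, fun n => ?_, fun n => ?_⟩
  · exact (hθ.continuous.measurable.comp (mu.div_const _)).mul
      (measurable_const.div (measurable_const.add ((mv.div_const _).pow_const 2)))
  · exact (hθ.continuous.measurable.comp (mu.div_const _)).mul
      ((Real.measurable_arctan.comp (mv.div_const _)).div (mv.div_const _))
  · exact ((cθ'.measurable.comp (mu.div_const _)).div_const _).mul
      ((Real.measurable_arctan.comp (mv.div_const _)).const_mul _)
  · exact ⟨mul_nonneg (θ0 _) (A1 _).1, mul_le_one₀ (θ1 _) (A1 _).1 (A1 _).2⟩
  · have := Real.arctan_div_self_mem_Icc (fn v x / c n)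
    exact ⟨mul_nonneg (θ0 _) this.1, mul_le_one₀ (θ1 _) this.1 this.2⟩
  · rw [abs_mul]
    refine (mul_le_mul (bθ' n _) (bτ n _) (abs_nonneg _) (by positivity)).trans (le_of_eq ?_)
    change _ = C * 2 / c n
    have := (cpos n).ne'
    field_simp
  · exact (θsupp' n x (left_ne_zero_of_mul h)).trans (R1 n)
  · exact (θsupp' n x (left_ne_zero_of_mul h)).trans (R1 n)
  · dsimp only
    rw [be, abs_mul, abs_of_nonneg (θ0 _)]
    have h1 := mul_le_mul (θ1 (fn u x / c n ^ 2)) (bτ n (fn v x)) (abs_nonneg _) zero_le_one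
    linarith [c2 n]
  · have h0 : Tendsto (fun n => fn v x / c n) atTop (𝓝 0) := ct.const_div_atTop _
    have h1 : Tendsto (fun n => 1 / (1 + (fn v x / c n) ^ 2)) atTop (𝓝 (1 / (1 + 0 ^ 2))) :=
      tendsto_const_nhds.div (tendsto_const_nhds.add (h0.pow 2)) (by norm_num)
    simpa using (θlim x).mul h1
  · simp only [be]
    simpa using (θlim x).mul (tendsto_mul_arctan_div (fn v x) cpos ct)
  · simp only [be]
    exact hz n
  · exact hz' n

end H10

/-! ### Measurability and integrability of the terms of the equation. -/

section Integrand

variable {N : ℕ} {Ω : Set (RN N)} {j : RN N → ℝ → RN N → ℝ}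

theorem IsC1Integrand.aemeasurable_comp (hj : IsC1Integrand Ω j) {s : RN N → ℝ}
    {ξ : RN N → RN N} (hs : StronglyMeasurable s) (hξ : StronglyMeasurable ξ) :
    AEMeasurable (fun x => j x (s x) (ξ x)) (volume.restrict Ω) :=
  aemeasurable_comp_of_continuous (X := ℝ × RN N) (f := fun x p => j x p.1 p.2)
    (fun p => hj.measurable p.1 p.2) (hj.contDiff.mono fun _ h => h.continuous)
    (hs.prodMk hξ)

/-- Writes derivatives as limits of sequences of difference quotients, so that they inherit
measurability from `j`. -/
theorem tendsto_mul_sub_of_hasDerivAt {f : ℝ → ℝ} {f' : ℝ} (h : HasDerivAt f f' 0) :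
    Tendsto (fun n : ℕ => ((n : ℝ) + 1) * (f ((n : ℝ) + 1)⁻¹ - f 0)) atTop (𝓝 f') := by
  have h0 : Tendsto (fun n : ℕ => ((n : ℝ) + 1)⁻¹) atTop (𝓝[≠] 0) :=
    tendsto_nhdsWithin_iff.2 ⟨tendsto_inv_atTop_zero.comp tendsto_natCast_add_one_atTop,
      Eventually.of_forall fun n => inv_ne_zero (by positivity)⟩
  refine ((hasDerivAt_iff_tendsto_slope.1 h).comp h0).congr fun n => ?_
  simp [slope_def_field, div_eq_mul_inv, mul_comm]

theorem IsC1Integrand.aestronglyMeasurable_partialS (hj : IsC1Integrand Ω j) (u : H10 Ω) :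
    AEStronglyMeasurable (fun x => partialS j x (H10.fn u x) (H10.grad u x))
      (volume.restrict Ω) := by
  refine (aemeasurable_of_tendsto_metrizable_ae atTop (f := fun (n : ℕ) x => ((n : ℝ) + 1) *
    (j x (H10.fn u x + ((n : ℝ) + 1)⁻¹) (H10.grad u x) - j x (H10.fn u x) (H10.grad u x)))
    (fun n => ?_) ?_).aestronglyMeasurable
  · exact ((hj.aemeasurable_comp ((H10.stronglyMeasurable_fn u).add stronglyMeasurable_const)
      (H10.stronglyMeasurable_grad u)).sub
      (hj.aemeasurable_comp (H10.stronglyMeasurable_fn u) (H10.stronglyMeasurable_grad u))).const_mul _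
  · filter_upwards [hj.contDiff] with x hx
    have hd : DifferentiableAt ℝ (fun t => j x t (H10.grad u x)) (H10.fn u x) :=
      ((hx.differentiable one_ne_zero).comp
        (differentiable_id.prodMk (differentiable_const _))) _
    have h := hd.hasDerivAt
    rw [← add_zero (H10.fn u x)] at h
    simpa [partialS] using tendsto_mul_sub_of_hasDerivAt (h.comp_const_add (H10.fn u x) 0)

/-- The term is the derivative of `j(x, u, ·)` at `∇u` in the direction `∇v`, so scalar difference
quotients suffice. -/
theorem IsC1Integrand.aestronglyMeasurable_xiTerm (hj : IsC1Integrand Ω j) (u v : H10 Ω) :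
    AEStronglyMeasurable (xiTerm j u v) (volume.restrict Ω) := by
  refine (aemeasurable_of_tendsto_metrizable_ae atTop (f := fun (n : ℕ) x => ((n : ℝ) + 1) *
    (j x (H10.fn u x) (H10.grad u x + ((n : ℝ) + 1)⁻¹ • H10.grad v x) -
      j x (H10.fn u x) (H10.grad u x)))
    (fun n => ?_) ?_).aestronglyMeasurable
  · have hξ : StronglyMeasurable fun x => H10.grad u x + ((n : ℝ) + 1)⁻¹ • H10.grad v x :=
      (H10.stronglyMeasurable_grad u).add ((H10.stronglyMeasurable_grad v).fun_const_smul _)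
    exact ((hj.aemeasurable_comp (H10.stronglyMeasurable_fn u) hξ).sub
      (hj.aemeasurable_comp (H10.stronglyMeasurable_fn u) (H10.stronglyMeasurable_grad u))).const_mul _
  · filter_upwards [hj.contDiff] with x hx
    have hd : DifferentiableAt ℝ (fun ζ => j x (H10.fn u x) ζ)
        (H10.grad u x + (0 : ℝ) • H10.grad v x) :=
      ((hx.differentiable one_ne_zero).comp
        ((differentiable_const _).prodMk differentiable_id)) _
    have hl : HasDerivAt (fun t : ℝ => H10.grad u x + t • H10.grad v x) (H10.grad v x) 0 := by
      simpa using ((hasDerivAt_id (0 : ℝ)).smul_const (H10.grad v x)).const_add (H10.grad u x)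
    have h := tendsto_mul_sub_of_hasDerivAt (hd.hasFDerivAt.comp_hasDerivAt 0 hl)
    simpa [xiTerm, partialXi, inner_gradient_left] using h

theorem exists_bound_comp_nnnorm {g : ℝ≥0 → ℝ≥0} (hg : Continuous g) (R : ℝ) :
    ∃ M : ℝ, 0 ≤ M ∧ ∀ s : ℝ, |s| ≤ R → (g ‖s‖₊ : ℝ) ≤ M := by
  obtain ⟨M, hM⟩ := (isCompact_Icc (a := -R) (b := R)).exists_bound_of_continuousOn
    (f := fun s : ℝ => (g ‖s‖₊ : ℝ))
    (NNReal.continuous_coe.comp (hg.comp continuous_nnnorm)).continuousOn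
  -- If `R < 0` the interval is empty and `M` may be negative.
  refine ⟨max M 0, le_max_right _ _, fun s hs => ?_⟩
  exact ((le_abs_self _).trans (hM s (abs_le.1 hs))).trans (le_max_left _ _)

/-- On sets where `|u| ≤ R`, the derivatives of `j` along `u` have the natural growth with uniform
constants. -/
theorem HasDerivGrowth.exists_bound (h : HasDerivGrowth Ω j) (u : H10 Ω) (R : ℝ) :
    ∃ M : ℝ, 0 ≤ M ∧ ∀ᵐ x ∂(volume.restrict Ω), |H10.fn u x| ≤ R →
      |partialS j x (H10.fn u x) (H10.grad u x)| ≤ M * ‖H10.grad u x‖ ^ 2 ∧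
      ‖partialXi j x (H10.fn u x) (H10.grad u x)‖ ≤ M * ‖H10.grad u x‖ := by
  obtain ⟨γ, μ, hγ, hμ, hb⟩ := h
  obtain ⟨M₁, h1, hM₁⟩ := exists_bound_comp_nnnorm hγ R
  obtain ⟨M₂, h2, hM₂⟩ := exists_bound_comp_nnnorm hμ R
  refine ⟨M₁ + M₂, add_nonneg h1 h2, ?_⟩
  filter_upwards [hb] with x hx hR
  obtain ⟨k1, k2⟩ := hx (H10.fn u x) (H10.grad u x)
  constructor
  · refine k1.trans (mul_le_mul_of_nonneg_right ?_ (by positivity))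
    linarith [hM₁ _ hR]
  · refine k2.trans (mul_le_mul_of_nonneg_right ?_ (by positivity))
    linarith [hM₂ _ hR]

theorem H10.integrable_norm_grad_sq (u : H10 Ω) :
    Integrable (fun x => ‖grad u x‖ ^ 2) (volume.restrict Ω) :=
  (memLp_two_iff_integrable_sq_norm (H10.memLp_grad u).1).1 (H10.memLp_grad u)

/-- Where `a ≠ 0` the growth condition gives the bound `M |∇u| |∇v|`, a product of two `L²`
functions. -/
theorem HasDerivGrowth.integrable_mul_xiTerm (h : HasDerivGrowth Ω j) (hj : IsC1Integrand Ω j)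
    (u v : H10 Ω) {a : RN N → ℝ} (ha : Measurable a) (ha1 : ∀ x, 0 ≤ a x ∧ a x ≤ 1) {R : ℝ}
    (hR : ∀ x, a x ≠ 0 → |H10.fn u x| ≤ R) :
    Integrable (fun x => a x * xiTerm j u v x) (volume.restrict Ω) := by
  obtain ⟨M, M0, hM⟩ := h.exists_bound u R
  have hi : Integrable (fun x => M * (‖H10.grad u x‖ * ‖H10.grad v x‖)) (volume.restrict Ω) :=
    ((H10.memLp_grad u).norm.integrable_mul (H10.memLp_grad v).norm).const_mul M
  refine hi.mono' (ha.aestronglyMeasurable.mul (hj.aestronglyMeasurable_xiTerm u v)) ?_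
  filter_upwards [hM] with x hx
  rcases eq_or_ne (a x) 0 with h0 | h0
  · rw [h0, zero_mul, norm_zero]
    positivity
  rw [norm_mul, Real.norm_of_nonneg (ha1 x).1, ← mul_assoc]
  refine (mul_le_of_le_one_left (norm_nonneg _) (ha1 x).2).trans ?_
  exact (norm_inner_le_norm _ _).trans
    (mul_le_mul_of_nonneg_right (hx (hR x h0)).2 (norm_nonneg _))

/-- The growth of `j_s` yields only `|∇u|² ∈ L¹`, so the other factor `b v` has to be bounded. -/
theorem HasDerivGrowth.integrable_mul_sTerm (h : HasDerivGrowth Ω j) (hj : IsC1Integrand Ω j)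
    (u v : H10 Ω) {b : RN N → ℝ} (hb : Measurable b) {R : ℝ}
    (hR : ∀ x, b x ≠ 0 → |H10.fn u x| ≤ R) (hbR : ∀ x, |b x * H10.fn v x| ≤ R) :
    Integrable (fun x => b x * sTerm j u v x) (volume.restrict Ω) := by
  obtain ⟨M, M0, hM⟩ := h.exists_bound u R
  have R0 : 0 ≤ R := (abs_nonneg _).trans (hbR 0)
  have hi : Integrable (fun x => M * ‖H10.grad u x‖ ^ 2 * R) (volume.restrict Ω) :=
    ((H10.integrable_norm_grad_sq u).const_mul M).mul_const R
  refine hi.mono' (hb.aestronglyMeasurable.mul ((hj.aestronglyMeasurable_partialS u).mul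
    (H10.stronglyMeasurable_fn v).aestronglyMeasurable)) ?_
  filter_upwards [hM] with x hx
  rcases eq_or_ne (b x) 0 with h0 | h0
  · rw [h0, zero_mul, norm_zero]
    positivity
  rw [sTerm, mul_left_comm, norm_mul]
  exact mul_le_mul (hx (hR x h0)).1 (hbR x) (norm_nonneg _) (by positivity)

end Integrand

/-! ### Passage to the limit in the equation, and the sign condition. -/

section Main

variable {N : ℕ} {Ω : Set (RN N)} {j : RN N → ℝ → RN N → ℝ}

lemma xiTerm_ae_eq {u v z : H10 Ω} {a d : RN N → ℝ}
    (h : H10.grad z =ᵐ[volume.restrict Ω] fun x => d x • H10.grad u x + a x • H10.grad v x) :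
    xiTerm j u z =ᵐ[volume.restrict Ω] fun x => d x * xiTerm j u u x + a x * xiTerm j u v x := by
  filter_upwards [h] with x hx
  simp only [xiTerm, hx, inner_add_right, real_inner_smul_right]

lemma sTerm_ae_eq {u v z : H10 Ω} {b : RN N → ℝ}
    (h : H10.fn z =ᵐ[volume.restrict Ω] fun x => b x * H10.fn v x) :
    sTerm j u z =ᵐ[volume.restrict Ω] fun x => b x * sTerm j u v x := by
  filter_upwards [h] with x hx
  simp only [sTerm, hx, mul_left_comm]

lemma mem_Vspace_of_bound [IsFiniteMeasure (volume.restrict Ω)] {u v z : H10 Ω} {b : RN N → ℝ}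
    {R : ℝ} (h : H10.fn z =ᵐ[volume.restrict Ω] fun x => b x * H10.fn v x)
    (hR : ∀ x, b x ≠ 0 → |H10.fn u x| ≤ R) (hbR : ∀ x, |b x * H10.fn v x| ≤ R) :
    z ∈ Vspace Ω (H10.fn u) := by
  have hs : MeasurableSet {x | H10.fn z x ≠ 0} :=
    (H10.stronglyMeasurable_fn z).measurable (measurableSet_singleton 0).compl
  constructor
  · refine MemLp.of_bound (H10.stronglyMeasurable_fn z).aestronglyMeasurable R ?_
    filter_upwards [h] with x hx
    rw [hx]
    exact hbR x
  · refine MemLp.of_bound (H10.stronglyMeasurable_fn u).aestronglyMeasurable R ?_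
    rw [ae_restrict_iff' hs]
    filter_upwards [h] with x hx hx0
    exact hR x (left_ne_zero_of_mul (hx ▸ hx0))

/-- A positive lower bound does not survive multiplication by `a ≤ 1`, whence `-|t|` in place of
`t`. -/
lemma neg_abs_le_mul {a t y : ℝ} (ha : 0 ≤ a ∧ a ≤ 1) (h : t ≤ y) : -|t| ≤ a * y := by
  have h1 : -|t| ≤ y := (neg_abs_le t).trans h
  nlinarith [mul_nonneg ha.1 (sub_nonneg.2 h1), mul_nonneg (sub_nonneg.2 ha.2) (abs_nonneg t)]

lemma abs_mul_le_abs {a y : ℝ} (ha : 0 ≤ a ∧ a ≤ 1) : |a * y| ≤ |y| := by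
  rw [abs_mul, abs_of_nonneg ha.1]
  exact mul_le_of_le_one_left (abs_nonneg _) ha.2

/-- The admissible test functions of the Euler equation include every `v ∈ H¹₀(Ω)` for which both
terms are bounded below by an integrable function. -/
theorem integrable_and_euler_of_bounded_below [IsFiniteMeasure (volume.restrict Ω)]
    (hj : IsC1Integrand Ω j) (hgrowth : HasDerivGrowth Ω j) (w : Hminus1 Ω) (u : H10 Ω)
    (heq : ∀ z ∈ Vspace Ω (H10.fn u),
      (∫ x in Ω, xiTerm j u z x) + (∫ x in Ω, sTerm j u z x) = w z)
    (hu : IntegrableOn (xiTerm j u u) Ω) (v : H10 Ω) (η : RN N → ℝ) (hη : IntegrableOn η Ω)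
    (hs : ∀ᵐ x ∂(volume.restrict Ω), η x ≤ sTerm j u v x)
    (hξ : ∀ᵐ x ∂(volume.restrict Ω), η x ≤ xiTerm j u v x) :
    IntegrableOn (xiTerm j u v) Ω ∧ IntegrableOn (sTerm j u v) Ω ∧
      (∫ x in Ω, xiTerm j u v x) + (∫ x in Ω, sTerm j u v x) = w v := by
  obtain ⟨z, a, b, d, R, K, ma, mb, md, ha, hb, hd, haR, hbR, hbv, alim, blim, zfn, zgrad⟩ :=
    H10.exists_truncation u v
  have K0 : 0 ≤ K := by simpa using (abs_nonneg _).trans (hd 0 0)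
  have Klim : Tendsto (fun n : ℕ => K / ((n : ℝ) + 1)) atTop (𝓝 0) :=
    tendsto_natCast_add_one_atTop.const_div_atTop K
  have Kle : ∀ n : ℕ, K / ((n : ℝ) + 1) ≤ K := fun n => div_le_self K0 (by simp)
  have dlim : ∀ x, Tendsto (fun n => d n x) atTop (𝓝 0) := fun x =>
    squeeze_zero_norm (fun n => hd n x) Klim
  have ia := fun n => hgrowth.integrable_mul_xiTerm hj u v (ma n) (ha n) (haR n)
  have ib := fun n => hgrowth.integrable_mul_sTerm hj u v (mb n) (hbR n) (hbv n)
  have dbound : ∀ n, ∀ᵐ x ∂(volume.restrict Ω), ‖d n x * xiTerm j u u x‖ ≤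
      K * |xiTerm j u u x| := fun n => Eventually.of_forall fun x => by
    rw [norm_mul]
    exact mul_le_mul_of_nonneg_right ((hd n x).trans (Kle n)) (abs_nonneg _)
  have dmeas : ∀ n, AEStronglyMeasurable (fun x => d n x * xiTerm j u u x) (volume.restrict Ω) :=
    fun n => (md n).aestronglyMeasurable.mul hu.1
  have id : ∀ n, Integrable (fun x => d n x * xiTerm j u u x) (volume.restrict Ω) := fun n =>
    (hu.abs.const_mul K).mono' (dmeas n) (dbound n)
  -- The error from differentiating the cutoff: `d n → 0` uniformly and `xiTerm j u u` is
  -- integrable.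
  have I0 : Tendsto (fun n => ∫ x in Ω, d n x * xiTerm j u u x) atTop (𝓝 0) := by
    have := tendsto_integral_of_dominated_convergence (μ := volume.restrict Ω)
      (F := fun n x => d n x * xiTerm j u u x) (f := fun _ => 0) _ dmeas (hu.abs.const_mul K)
      dbound (Eventually.of_forall fun x => by simpa using (dlim x).mul_const (xiTerm j u u x))
    simpa using this
  have zv : Tendsto z atTop (𝓝 v) := by
    refine H10.tendsto_iff.2 ⟨?_, ?_⟩
    · refine tendsto_eLpNorm_two_of_dominated (b := fun x => |H10.fn v x|)
        (fun n => (H10.memLp_fn (z n)).1) (H10.memLp_fn v).norm (fun n => ?_) ?_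
      · filter_upwards [zfn n] with x hx
        rw [hx]
        exact abs_mul_le_abs (hb n x)
      · filter_upwards [ae_all_iff.2 zfn] with x hx
        simpa only [hx] using blim x
    · refine tendsto_eLpNorm_two_of_dominated
        (b := fun x => K * ‖H10.grad u x‖ + ‖H10.grad v x‖)
        (fun n => (H10.memLp_grad (z n)).1) (((H10.memLp_grad u).norm.const_mul K).add (H10.memLp_grad v).norm)
        (fun n => ?_) ?_
      · filter_upwards [zgrad n] with x hx
        rw [hx]
        refine (norm_add_le _ _).trans (add_le_add ?_ ?_)
        · rw [norm_smul]
          exact mul_le_mul_of_nonneg_right ((hd n x).trans (Kle n)) (norm_nonneg _)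
        · rw [norm_smul, Real.norm_of_nonneg (ha n x).1]
          exact mul_le_of_le_one_left (norm_nonneg _) (ha n x).2
      · filter_upwards [ae_all_iff.2 zgrad] with x hx
        simp only [hx]
        simpa using ((dlim x).smul_const (H10.grad u x)).add
          ((alim x).smul_const (H10.grad v x))
  have euler : ∀ n, (∫ x in Ω, a n x * xiTerm j u v x) + (∫ x in Ω, b n x * sTerm j u v x) =
      w (z n) - ∫ x in Ω, d n x * xiTerm j u u x := by
    intro n
    have h := heq (z n) (mem_Vspace_of_bound (zfn n) (hbR n) (hbv n))
    rw [integral_congr_ae (xiTerm_ae_eq (zgrad n)), integral_congr_ae (sTerm_ae_eq (zfn n)),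
      integral_add (id n) (ia n)] at h
    linarith
  refine integrable_and_integral_add_eq_of_tendsto hη ia ib
    (fun n => hξ.mono fun x hx => neg_abs_le_mul (ha n x) hx)
    (fun n => hs.mono fun x hx => neg_abs_le_mul (hb n x) hx)
    (fun n => Eventually.of_forall fun x => abs_mul_le_abs (ha n x))
    (fun n => Eventually.of_forall fun x => abs_mul_le_abs (hb n x))
    (Eventually.of_forall fun x => by simpa using (alim x).mul_const (xiTerm j u v x))
    (Eventually.of_forall fun x => ?_) ?_
  · refine ((blim x).const_mul (partialS j x (H10.fn u x) (H10.grad u x))).congr fun n => ?_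
    simp only [sTerm, mul_left_comm]
  · simp only [euler]
    simpa using ((w.continuous.tendsto v).comp zv).sub I0

/-- Under the sign condition, `j_s(x, u, ∇u) ζ u` is bounded below by an integrable function. -/
theorem exists_integrable_le_sTerm (hgrowth : HasDerivGrowth Ω j)
    (hsign : SignCondition Ω j) (u : H10 Ω) (hu : IntegrableOn (xiTerm j u u) Ω)
    {ζ : RN N → ℝ} (hζ : MemLp ζ ∞ (volume.restrict Ω))
    (hζ0 : ∀ᵐ x ∂(volume.restrict Ω), 0 ≤ ζ x) {ζu : H10 Ω}
    (hζu : ∀ᵐ x ∂(volume.restrict Ω), H10.fn ζu x = ζ x * H10.fn u x) :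
    ∃ η : RN N → ℝ, IntegrableOn η Ω ∧ ∀ᵐ x ∂(volume.restrict Ω), η x ≤ sTerm j u ζu x := by
  obtain ⟨ε, R, hε0, hε1, hR, hsg⟩ := hsign
  obtain ⟨M, M0, hM⟩ := hgrowth.exists_bound u R
  obtain ⟨Z, hZ⟩ : ∃ Z : ℝ, ∀ᵐ x ∂(volume.restrict Ω), ‖ζ x‖ ≤ Z :=
    ⟨_, ae_le_lpNorm_exponent_top hζ⟩
  have i1 := (H10.integrable_norm_grad_sq u).const_mul (Z * R * M)
  have i2 : Integrable (fun x => Z * |xiTerm j u u x| + Z * R * M * ‖H10.grad u x‖ ^ 2)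
      (volume.restrict Ω) := (hu.abs.const_mul Z).add i1
  -- The first term bounds the region `|u| ≥ R`, where the sign condition gives `j_s u ≥ -(1 - ε)
  -- j_ξ·∇u`; the second bounds `|u| ≤ R`, where `|j_s u| ≤ M |∇u|² R`.
  refine ⟨fun x => -(Z * |xiTerm j u u x| + Z * R * M * ‖H10.grad u x‖ ^ 2), i2.neg, ?_⟩
  filter_upwards [hsg, hM, hZ, hζ0, hζu] with x sx mx zx z0 ex
  rw [Real.norm_of_nonneg z0] at zx
  have Z0 : 0 ≤ Z := z0.trans zx
  have g0 : 0 ≤ M * ‖H10.grad u x‖ ^ 2 := by positivity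
  have e : sTerm j u ζu x = ζ x * (partialS j x (H10.fn u x) (H10.grad u x) * H10.fn u x) := by
    simp only [sTerm, ex, mul_left_comm]
  rw [e]
  rcases le_total R |H10.fn u x| with h | h
  · have h1 := sx (H10.fn u x) (H10.grad u x) h
    have h2 : (1 - ε) * xiTerm j u u x ≤ |xiTerm j u u x| :=
      (le_abs_self _).trans (abs_mul_le_abs ⟨by linarith, by linarith⟩)
    have h3 : -|xiTerm j u u x| ≤ partialS j x (H10.fn u x) (H10.grad u x) * H10.fn u x := by
      simp only [xiTerm] at h2 ⊢
      linarith
    have h4 := mul_le_mul_of_nonneg_left h3 z0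
    have h5 := mul_le_mul_of_nonneg_right zx (abs_nonneg (xiTerm j u u x))
    have h6 := mul_nonneg (mul_nonneg Z0 hR) g0
    linarith
  · have h1 : |partialS j x (H10.fn u x) (H10.grad u x) * H10.fn u x| ≤
        M * ‖H10.grad u x‖ ^ 2 * R := by
      rw [abs_mul]
      exact mul_le_mul (mx h).1 h (abs_nonneg _) g0
    have h2 := mul_le_mul_of_nonneg_left (abs_le.1 h1).1 z0
    have h3 := mul_le_mul_of_nonneg_right zx (mul_nonneg g0 hR)
    have h4 := mul_nonneg Z0 (abs_nonneg (xiTerm j u u x))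
    linarith

end Main

theorem proposition2p12 {N : ℕ} (Ω : Set (RN N)) (hΩ : IsOpen Ω) (hΩb : Bornology.IsBounded Ω)
    (j : RN N → ℝ → RN N → ℝ) (hj : IsC1Integrand Ω j) (hgrowth : HasDerivGrowth Ω j)
    (w : Hminus1 Ω) (u : H10 Ω)
    (heq : ∀ z ∈ Vspace Ω (H10.fn u),
      (∫ x in Ω, xiTerm j u z x) + (∫ x in Ω, sTerm j u z x) = w z)
    (hu : IntegrableOn (xiTerm j u u) Ω) :
    (∀ (v : H10 Ω) (η : RN N → ℝ), IntegrableOn η Ω →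
      (∀ᵐ x ∂(volume.restrict Ω), η x ≤ sTerm j u v x) →
      (∀ᵐ x ∂(volume.restrict Ω), η x ≤ xiTerm j u v x) →
      IntegrableOn (sTerm j u v) Ω ∧ IntegrableOn (xiTerm j u v) Ω ∧
        (∫ x in Ω, xiTerm j u v x) + (∫ x in Ω, sTerm j u v x) = w v) ∧
    (SignCondition Ω j →
      ∀ ζ : RN N → ℝ, MemLp ζ ∞ (volume.restrict Ω) →
        (∀ᵐ x ∂(volume.restrict Ω), 0 ≤ ζ x) →
        ∀ ζu : H10 Ω, (∀ᵐ x ∂(volume.restrict Ω), (H10.fn ζu) x = ζ x * (H10.fn u) x) →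
          IntegrableOn (xiTerm j u ζu) Ω →
          IntegrableOn (sTerm j u ζu) Ω ∧
            (∫ x in Ω, xiTerm j u ζu x) + (∫ x in Ω, sTerm j u ζu x) = w ζu) := by
  have : IsFiniteMeasure (volume.restrict Ω) := isFiniteMeasure_restrict.2 hΩb.measure_lt_top.ne
  have key := integrable_and_euler_of_bounded_below hj hgrowth w u heq hu
  refine ⟨fun v η hη hs hξ => ?_, fun hsign ζ hζ hζ0 ζu hζu hξ => ?_⟩
  · obtain ⟨h1, h2, h3⟩ := key v η hη hs hξ
    exact ⟨h2, h1, h3⟩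
  · obtain ⟨η, hη, hle⟩ := exists_integrable_le_sTerm hgrowth hsign u hu hζ hζ0 hζu
    -- The gradient term is integrable by hypothesis, so it can enter its own lower bound.
    obtain ⟨-, h2, h3⟩ := key ζu (fun x => min (η x) (xiTerm j u ζu x)) (hη.inf hξ)
      (hle.mono fun x hx => (min_le_left _ _).trans hx)
      (Eventually.of_forall fun x => min_le_right _ _)
    exact ⟨h2, h3⟩
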